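/- Let $(\Omega,\mu)$ be a measure space with a $\sigma$-finite measure, let $G$ be a group, and let $\alpha_g:\Omega\to\Omega$, $g\in G$, be a group of measurable maps ($\alpha_e=\mathrm{id}$, $\alpha_{gh}=\alpha_g\circ\alpha_h$) that preserve the equivalence class of $\mu$, i.e. the image measure $\mu\circ\alpha_g^{-1}$ and $\mu$ have the same null sets. Assume that $G$ acts metrically freely: for every finite set $S\subset G$ and every measurable $\Delta$ with $\mu(\Delta)>0$ there is a measurable $\Delta'\subset\Delta$ with $\mu(\Delta')>0$ and $\mu(\alpha_g(\Delta')\cap\alpha_h(\Delta'))=0$ for all $g\ne h$ in $S$. Let $E$ be a Banach space over $\mathbb K\in\{\mathbb R,\mathbb C\}$, with dual $E^*$ and algebra $L(E)$ of bounded operators, and let $D=L^1_\mu(\Omega,E)$. An element $a\in L^\infty_\mu(\Omega,L(E))$ acts on $D$ as the multiplication operator $(af)(x)=a(x)f(x)$, and for $g\in G$ let $T_g$ be the isometry of $D$ given by $$(T_gf)(x)=\frac{d(\mu\circ\alpha_g^{-1})}{d\mu}(x)\,f(\alpha_g^{-1}(x)).$$ For a finite set $F\subset G$ put $B_F(E^*)=\{(f_g)_{g\in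 F}: f_g\in E^*,\ \|f_g\|\le1\}$ and $S_F(E^*)=\{(f_g)_{g\in F}: f_g\in E^*,\ \|f_g\|=1\}$. Then for every finite $F\subset G$ and all $a_g\in L^\infty_\mu(\Omega,L(E))$, $g\in F$, $$\Big\|\sum_{g\in F}a_gT_g\Big\|=\operatorname*{ess\,sup}_{x\in\Omega}\ \sup_{(f_g)\in B_F(E^*)}\Big\|\sum_{g\in F}[a_g(\alpha_g(x))]^*f_g\Big\|=\operatorname*{ess\,sup}_{x\in\Omega}\ \sup_{(f_g)\in S_F(E^*)}\Big\|\sum_{g\in F}[a_g(\alpha_g(x))]^*f_g\Big\|,$$ where $[\,\cdot\,]^*$ is the Banach space adjoint and suprema are taken in $[0,\infty]$ (so the supremum over an empty set is $0$). If $E=\mathbb K$ (in particular if $E=\mathbb C$) and $a_g\in L^\infty_\mu(\Omega)$, $g\in F$, then $$\Big\|\sum_{g\in F}a_gT_g\Big\|=\operatorname*{ess\,sup}_{x\in\Omega}\ \sum_{g\in F}|a_g(\alpha_g(x))|.$$ -/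

import Mathlib

open MeasureTheory
open scoped ENNReal

noncomputable section

namespace WeightedComposition

/-- The action `(g, x) ↦ g • x` of `G` on `Ω` is by measurable maps that preserve the equivalence
class of `μ`: the image measure of `μ` under `x ↦ g • x` and `μ` have the same null sets. -/
class PreservesMeasureClass (G : Type*) {Ω : Type*} [Group G] [MulAction G Ω]
    [MeasurableSpace Ω] (μ : Measure Ω) : Prop where
  measurable_smul : ∀ g : G, Measurable (fun x : Ω => g • x)
  map_ac : ∀ g : G, μ.map (fun x : Ω => g • x) ≪ μ
  ac_map : ∀ g : G, μ ≪ μ.map (fun x : Ω => g • x)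

/-- Metrically free action: for any finite set of elements of `G`, every measurable set of positive
measure has a measurable subset of positive measure whose images under the pairwise distinct
elements of the finite set intersect in null sets. -/
def MetricallyFree (G : Type*) {Ω : Type*} [Group G] [MulAction G Ω]
    [MeasurableSpace Ω] (μ : Measure Ω) : Prop :=
  ∀ (S : Finset G) (Δ : Set Ω), MeasurableSet Δ → 0 < μ Δ →
    ∃ Δ' : Set Ω, MeasurableSet Δ' ∧ 0 < μ Δ' ∧ Δ' ⊆ Δ ∧
      ∀ g ∈ S, ∀ h ∈ S, g ≠ h →
        μ (((fun x : Ω => g • x) '' Δ') ∩ ((fun x : Ω => h • x) '' Δ')) = 0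

/-- The families `(f_g)_{g ∈ F}` in the closed unit ball of `X`. -/
def ballFamilies {G : Type*} (F : Finset G) (X : Type*) [NormedAddCommGroup X] : Set (F → X) :=
  {f | ∀ g, ‖f g‖ ≤ 1}

/-- The families `(f_g)_{g ∈ F}` in the unit sphere of `X`. -/
def sphereFamilies {G : Type*} (F : Finset G) (X : Type*) [NormedAddCommGroup X] : Set (F → X) :=
  {f | ∀ g, ‖f g‖ = 1}

/-- The Banach space adjoint `S^* : E^* → E^*`, `φ ↦ φ ∘ S`, of a bounded operator `S` on `E`. -/
def dualOp {𝕜 E : Type*} [RCLike 𝕜] [NormedAddCommGroup E] [NormedSpace 𝕜 E] (S : E →L[𝕜] E) :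
    StrongDual 𝕜 E →L[𝕜] StrongDual 𝕜 E :=
  ContinuousLinearMap.precomp 𝕜 S

section Mult

variable {Ω 𝕜 E : Type*} [MeasurableSpace Ω] {μ : Measure Ω} [RCLike 𝕜]
  [NormedAddCommGroup E] [NormedSpace 𝕜 E]

/-- The multiplication operator `(a f)(x) = a(x) f(x)` on `L¹(Ω, E)`, for `a ∈ L^∞(Ω, L(E))`. -/
def multOp (a : Lp (E →L[𝕜] E) ∞ μ) : Lp E 1 μ →L[𝕜] Lp E 1 μ :=
  (ContinuousLinearMap.id 𝕜 (E →L[𝕜] E)).holderL μ ∞ 1 1 a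

/-- The multiplication operator `(a f)(x) = a(x) f(x)` on `L¹(Ω)`, for `a ∈ L^∞(Ω)`. -/
def scalarMultOp (a : Lp 𝕜 ∞ μ) : Lp 𝕜 1 μ →L[𝕜] Lp 𝕜 1 μ :=
  (ContinuousLinearMap.mul 𝕜 𝕜).holderL μ ∞ 1 1 a

theorem multOp_ae (a : Lp (E →L[𝕜] E) ∞ μ) (f : Lp E 1 μ) :
    multOp a f =ᵐ[μ] fun x => a x (f x) :=
  ContinuousLinearMap.coeFn_holder (ContinuousLinearMap.id 𝕜 (E →L[𝕜] E)) a f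

theorem scalarMultOp_ae (a : Lp 𝕜 ∞ μ) (f : Lp 𝕜 1 μ) :
    scalarMultOp a f =ᵐ[μ] fun x => a x * f x :=
  ContinuousLinearMap.coeFn_holder (ContinuousLinearMap.mul 𝕜 𝕜) a f

end Mult

section Comp

variable {G Ω : Type*} (𝕜 : Type*) {E : Type*} [Group G] [MulAction G Ω] [MeasurableSpace Ω]
  (μ : Measure Ω) [RCLike 𝕜] [NormedAddCommGroup E] [NormedSpace 𝕜 E]

/-- The Radon-Nikodym derivative with respect to `μ` of the measure `Δ ↦ μ (g⁻¹ • Δ)`, that is, of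
the image of `μ` under `x ↦ g • x`. -/
def weight (g : G) (x : Ω) : ℝ := ((μ.map (fun y : Ω => g • y)).rnDeriv μ x).toReal

/-- The function `x ↦ w_g(x) f(g⁻¹ x)`, with `w_g` the weight above. -/
def wcompFun (g : G) (f : Ω → E) (x : Ω) : E := (weight μ g x : 𝕜) • f (g⁻¹ • x)

theorem quasi [PreservesMeasureClass G μ] (g : G) :
    Measure.QuasiMeasurePreserving (fun x : Ω => g • x) μ μ :=
  ⟨PreservesMeasureClass.measurable_smul μ g, PreservesMeasureClass.map_ac g⟩

theorem wcompFun_congr [PreservesMeasureClass G μ] (g : G) {f f' : Ω → E} (h : f =ᵐ[μ] f') :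
    wcompFun 𝕜 μ g f =ᵐ[μ] wcompFun 𝕜 μ g f' := by
  filter_upwards [(quasi μ g⁻¹).ae_eq_comp h] with x hx
  simp only [Function.comp_apply] at hx
  simp [wcompFun, hx]

theorem sigmaFinite_map [SigmaFinite μ] [PreservesMeasureClass G μ] (g : G) :
    SigmaFinite (μ.map (fun x : Ω => g • x)) :=
  MeasurableEquiv.sigmaFinite_map (μ := μ)
    ({ toEquiv := MulAction.toPerm g
       measurable_toFun := PreservesMeasureClass.measurable_smul μ g
       measurable_invFun := PreservesMeasureClass.measurable_smul μ g⁻¹ } : Ω ≃ᵐ Ω)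

theorem wcompFun_aesm [PreservesMeasureClass G μ] (g : G) {f : Ω → E}
    (hf : AEStronglyMeasurable f μ) : AEStronglyMeasurable (wcompFun 𝕜 μ g f) μ := by
  refine AEStronglyMeasurable.smul ?_ (hf.comp_quasiMeasurePreserving (quasi μ g⁻¹))
  exact (RCLike.measurable_ofReal.comp
    (Measure.measurable_rnDeriv _ _).ennreal_toReal).aestronglyMeasurable

theorem eLpNorm_wcompFun [SigmaFinite μ] [PreservesMeasureClass G μ] (g : G) {f : Ω → E}
    (hf : AEStronglyMeasurable f μ) : eLpNorm (wcompFun 𝕜 μ g f) 1 μ = eLpNorm f 1 μ := by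
  have := sigmaFinite_map μ g
  have hfg : AEMeasurable (fun x => ‖f (g⁻¹ • x)‖ₑ) μ :=
    (hf.comp_quasiMeasurePreserving (quasi μ g⁻¹)).enorm
  have hg := PreservesMeasureClass.map_ac (μ := μ) g
  rw [eLpNorm_one_eq_lintegral_enorm, eLpNorm_one_eq_lintegral_enorm]
  calc ∫⁻ x, ‖wcompFun 𝕜 μ g f x‖ₑ ∂μ
      = ∫⁻ x, (μ.map (fun y : Ω => g • y)).rnDeriv μ x * ‖f (g⁻¹ • x)‖ₑ ∂μ := by
        refine lintegral_congr_ae ?_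
        filter_upwards [Measure.rnDeriv_lt_top (μ.map (fun y : Ω => g • y)) μ] with x hx
        have h0 : ‖(weight μ g x : 𝕜)‖ₑ = (μ.map (fun y : Ω => g • y)).rnDeriv μ x := by
          rw [← ofReal_norm, RCLike.norm_ofReal, weight, abs_of_nonneg ENNReal.toReal_nonneg]
          exact ENNReal.ofReal_toReal hx.ne
        rw [wcompFun, enorm_smul, h0]
    _ = ∫⁻ x, ‖f (g⁻¹ • x)‖ₑ ∂(μ.map (fun y : Ω => g • y)) := lintegral_rnDeriv_mul hg hfg
    _ = ∫⁻ x, ‖f x‖ₑ ∂μ := by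
        rw [lintegral_map' (hfg.mono_ac hg)
          (PreservesMeasureClass.measurable_smul μ g).aemeasurable]
        simp

theorem wcompFun_memLp [SigmaFinite μ] [PreservesMeasureClass G μ] (g : G) {f : Ω → E}
    (hf : MemLp f 1 μ) : MemLp (wcompFun 𝕜 μ g f) 1 μ :=
  ⟨wcompFun_aesm 𝕜 μ g hf.1, by rw [eLpNorm_wcompFun 𝕜 μ g hf.1]; exact hf.2⟩

variable (E) in
/-- The weighted composition isometry `(T_g f)(x) = w_g(x) f(g⁻¹ x)` of `L¹(Ω, E)`. -/
def wcompIsometry [SigmaFinite μ] [PreservesMeasureClass G μ] (g : G) : Lp E 1 μ →ₗᵢ[𝕜] Lp E 1 μ where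
  toFun f := (wcompFun_memLp 𝕜 μ g (Lp.memLp f)).toLp _
  map_add' f f' := by
    rw [← MemLp.toLp_add, MemLp.toLp_eq_toLp_iff]
    refine (wcompFun_congr 𝕜 μ g (Lp.coeFn_add f f')).trans (.of_forall fun x => ?_)
    simp [wcompFun]
  map_smul' c f := by
    rw [RingHom.id_apply, ← MemLp.toLp_const_smul, MemLp.toLp_eq_toLp_iff]
    refine (wcompFun_congr 𝕜 μ g (Lp.coeFn_smul c f)).trans (.of_forall fun x => ?_)
    simp only [wcompFun, Pi.smul_apply]
    exact smul_comm _ _ _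
  norm_map' f := by
    change ‖(wcompFun_memLp 𝕜 μ g (Lp.memLp f)).toLp _‖ = ‖f‖
    rw [Lp.norm_toLp, eLpNorm_wcompFun 𝕜 μ g (Lp.memLp f).1, Lp.norm_def]

theorem wcompIsometry_ae [SigmaFinite μ] [PreservesMeasureClass G μ] (g : G) (f : Lp E 1 μ) :
    wcompIsometry 𝕜 E μ g f =ᵐ[μ] fun x =>
      (((μ.map (fun y : Ω => g • y)).rnDeriv μ x).toReal : 𝕜) • f (g⁻¹ • x) :=
  MemLp.coeFn_toLp (wcompFun_memLp 𝕜 μ g (Lp.memLp f))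

end Comp

end WeightedComposition

end

open WeightedComposition

/-!
The norm of `A = ∑ g ∈ F, a_g T_g` is first computed in terms of vectors of `E`:
`‖A‖ = ess sup_x N(x)` with `N(x) = sup_{‖u‖ ≤ 1} ∑ g ∈ F, ‖a_g(g x) u‖`.

* Upper bound (`enorm_le_essSup_of_ae_eq_sum`). Multiplying by `b` after `T_g` is the same as
  multiplying by `b(g ·)` before `T_g`, and `T_g` preserves the `L¹` norm, so
  `‖a_g T_g f‖₁ = ∫ ‖a_g(g x) f(x)‖`. The triangle inequality gives
  `‖A f‖₁ ≤ ∫ ∑ g ∈ F, ‖a_g(g x) f(x)‖ ≤ ∫ N(x) ‖f(x)‖`.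
* Lower bound (`essSup_le_enorm_of_ae_eq_sum`). Let `c < ess sup N`. Strongly measurable functions
  have essentially separable range, so by the Lindelöf property one vector `u` of norm at most one
  satisfies `∑ g ∈ F, ‖a_g(g x) u‖ > c` on a set of positive measure, although the unit ball of `E`
  need not be separable. Metric freeness provides a subset `Δ` of positive finite measure whose
  translates by `F` are essentially disjoint. For `f = 1_Δ u` the functions `a_g T_g f` have
  disjoint supports, the triangle inequality is an equality, and `‖A f‖₁ ≥ c μ(Δ) ≥ c ‖f‖₁`.

The vector supremum `N(x)` is then identified with the suprema over functionals
(`iSup_ballFamilies_eq`, `iSup_sphereFamilies_eq`): `∑ S_g^* f_g` evaluated at `u` is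
`∑ f_g (S_g u)`, and Hahn-Banach supplies norm-one functionals `f_g` with `f_g (S_g u) = ‖S_g u‖`.
For `E = 𝕜` the vector supremum is attained at `u = 1`.
-/

namespace WeightedComposition

/-! ### Strongly measurable functions and open covers -/

theorem enorm_le_one_iff {V : Type*} [SeminormedAddCommGroup V] {v : V} : ‖v‖ₑ ≤ 1 ↔ ‖v‖ ≤ 1 := by
  rw [← ofReal_norm, ENNReal.ofReal_le_one]

/-- If a strongly measurable function takes values in a union of open sets on a non-null set, then
it does so for one of these sets: its essential range is separable, hence Lindelöf, so countably
many of the open sets suffice. -/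
theorem exists_frequently_mem_of_frequently_mem_iUnion {Ω X ι : Type*} [MeasurableSpace Ω]
    {μ : Measure Ω} [TopologicalSpace X] [TopologicalSpace.PseudoMetrizableSpace X]
    {b : Ω → X} (hb : AEStronglyMeasurable b μ) {U : ι → Set X} (hU : ∀ i, IsOpen (U i))
    (h : ∃ᶠ x in ae μ, b x ∈ ⋃ i, U i) : ∃ i, ∃ᶠ x in ae μ, b x ∈ U i := by
  obtain ⟨b', hb', hbb'⟩ := hb
  have := hb'.isSeparable_range.secondCountableTopology
  obtain ⟨T, hT, hTU⟩ := TopologicalSpace.isOpen_iUnion_countable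
    (fun i => ((↑) : Set.range b' → X) ⁻¹' U i) fun i => (hU i).preimage continuous_subtype_val
  by_contra! hc
  refine h ?_
  have hT' : ∀ᵐ x ∂μ, ∀ i ∈ T, b x ∉ U i := (ae_ball_iff hT).2 fun i _ => by simpa using hc i
  filter_upwards [hT', hbb'] with x hx hxb hmem
  have hx' : (⟨b' x, x, rfl⟩ : Set.range b') ∈ ⋃ i, ((↑) : Set.range b' → X) ⁻¹' U i := by
    simpa [← hxb] using hmem
  rw [← hTU] at hx'
  simp only [Set.mem_iUnion, Set.mem_preimage, ← hxb] at hx'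
  obtain ⟨i, hi, hi'⟩ := hx'
  exact hx i hi hi'

theorem aestronglyMeasurable_pi {Ω ι : Type*} [MeasurableSpace Ω] {μ : Measure Ω} [Fintype ι]
    {X : ι → Type*} [∀ i, TopologicalSpace (X i)] [∀ i, AddCommMonoid (X i)]
    [∀ i, ContinuousAdd (X i)] {b : Ω → ∀ i, X i}
    (hb : ∀ i, AEStronglyMeasurable (fun x => b x i) μ) : AEStronglyMeasurable b μ := by
  classical
  have h : b = fun x => ∑ i, Pi.single i (b x i) :=
    funext fun x => (Finset.univ_sum_single (b x)).symm
  rw [h]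
  exact Finset.aestronglyMeasurable_fun_sum _ fun i _ =>
    (continuous_single i).comp_aestronglyMeasurable (hb i)

/-! ### Sums of weighted composition operators with operator coefficients -/

section Sum

variable {G Ω 𝕜 E : Type*} [Group G] [MulAction G Ω] [MeasurableSpace Ω]
  (μ : Measure Ω) [RCLike 𝕜]
  [NormedAddCommGroup E] [NormedSpace 𝕜 E]

/-- A multiplication operator moves past `T_g` at the cost of translating its coefficient. -/
theorem apply_wcompFun (g : G) (b : Ω → E →L[𝕜] E) (f : Ω → E) (x : Ω) :
    b x (wcompFun 𝕜 μ g f x) = wcompFun 𝕜 μ g (fun y => b (g • y) (f y)) x := by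
  simp [wcompFun]

variable [PreservesMeasureClass G μ]

theorem aestronglyMeasurable_smul_apply (g : G) {b : Ω → E →L[𝕜] E}
    (hb : AEStronglyMeasurable b μ) {f : Ω → E} (hf : AEStronglyMeasurable f μ) :
    AEStronglyMeasurable (fun x => b (g • x) (f x)) μ :=
  (ContinuousLinearMap.id 𝕜 (E →L[𝕜] E)).aestronglyMeasurable_comp₂
    (hb.comp_quasiMeasurePreserving (quasi μ g)) hf

theorem aemeasurable_enorm_apply_wcompFun (g : G) {b : Ω → E →L[𝕜] E}
    (hb : AEStronglyMeasurable b μ) {f : Ω → E} (hf : AEStronglyMeasurable f μ) :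
    AEMeasurable (fun x => ‖b x (wcompFun 𝕜 μ g f x)‖ₑ) μ := by
  simp only [apply_wcompFun]
  exact (wcompFun_aesm 𝕜 μ g (aestronglyMeasurable_smul_apply μ g hb hf)).enorm

variable [SigmaFinite μ]

theorem lintegral_enorm_apply_wcompFun (g : G) {b : Ω → E →L[𝕜] E}
    (hb : AEStronglyMeasurable b μ) {f : Ω → E} (hf : AEStronglyMeasurable f μ) :
    ∫⁻ x, ‖b x (wcompFun 𝕜 μ g f x)‖ₑ ∂μ = ∫⁻ x, ‖b (g • x) (f x)‖ₑ ∂μ := by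
  simp only [apply_wcompFun]
  simpa only [eLpNorm_one_eq_lintegral_enorm] using
    eLpNorm_wcompFun 𝕜 μ g (aestronglyMeasurable_smul_apply μ g hb hf)

theorem lintegral_sum_enorm_apply_wcompFun (F : Finset G) {b : G → Ω → E →L[𝕜] E}
    (hb : ∀ g, AEStronglyMeasurable (b g) μ) {f : Ω → E} (hf : AEStronglyMeasurable f μ) :
    ∫⁻ x, ∑ g ∈ F, ‖b g x (wcompFun 𝕜 μ g f x)‖ₑ ∂μ =
      ∫⁻ x, ∑ g ∈ F, ‖b g (g • x) (f x)‖ₑ ∂μ := by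
  rw [lintegral_finsetSum' _ fun g _ => aemeasurable_enorm_apply_wcompFun μ g (hb g) hf,
    lintegral_finsetSum' _ fun g _ => (aestronglyMeasurable_smul_apply μ g (hb g) hf).enorm]
  exact Finset.sum_congr rfl fun g _ => lintegral_enorm_apply_wcompFun μ g (hb g) hf

/-- Homogeneity in `v`: the supremum over the closed unit ball bounds the sum at every vector. -/
theorem sum_enorm_apply_le {ι : Type*} (s : Finset ι) (S : ι → E →L[𝕜] E) (v : E) :
    ∑ i ∈ s, ‖S i v‖ₑ ≤ (⨆ u ∈ Metric.closedBall (0 : E) 1, ∑ i ∈ s, ‖S i u‖ₑ) * ‖v‖ₑ := by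
  obtain rfl | hv := eq_or_ne v 0
  · simp
  have hv' : ‖v‖ ≠ 0 := norm_ne_zero_iff.2 hv
  set u : E := ((‖v‖⁻¹ : ℝ) : 𝕜) • v with hu
  have hu1 : u ∈ Metric.closedBall (0 : E) 1 := by
    simp [hu, norm_smul, inv_mul_cancel₀ hv']
  have hvu : v = ((‖v‖ : ℝ) : 𝕜) • u := by
    rw [hu, smul_smul, ← RCLike.ofReal_mul, mul_inv_cancel₀ hv']; simp
  calc ∑ i ∈ s, ‖S i v‖ₑ = (∑ i ∈ s, ‖S i u‖ₑ) * ‖v‖ₑ := by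
        rw [Finset.sum_mul]
        refine Finset.sum_congr rfl fun i _ => ?_
        conv_lhs => rw [hvu, map_smul, enorm_smul]
        rw [mul_comm]
        congr 1
        rw [← ofReal_norm, ← ofReal_norm]; simp
    _ ≤ _ := by gcongr; exact le_iSup₂ (f := fun u _ => ∑ i ∈ s, ‖S i u‖ₑ) u hu1

variable {μ} {F : Finset G} {b : G → Ω → E →L[𝕜] E} {A : Lp E 1 μ →L[𝕜] Lp E 1 μ}

theorem enorm_le_essSup_of_ae_eq_sum (hb : ∀ g, AEStronglyMeasurable (b g) μ)
    (hA : ∀ f, A f =ᵐ[μ] fun x => ∑ g ∈ F, b g x (wcompFun 𝕜 μ g f x)) :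
    ‖A‖ₑ ≤ essSup (fun x => ⨆ u ∈ Metric.closedBall (0 : E) 1, ∑ g ∈ F, ‖b g (g • x) u‖ₑ) μ := by
  refine ContinuousLinearMap.opENorm_le_bound _ fun f => ?_
  have hf := (Lp.memLp f).1
  rw [Lp.enorm_def, Lp.enorm_def, eLpNorm_one_eq_lintegral_enorm, eLpNorm_one_eq_lintegral_enorm,
    ← lintegral_const_mul'' _ hf.enorm]
  calc ∫⁻ x, ‖A f x‖ₑ ∂μ ≤ ∫⁻ x, ∑ g ∈ F, ‖b g x (wcompFun 𝕜 μ g f x)‖ₑ ∂μ := by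
        refine lintegral_mono_ae ?_
        filter_upwards [hA f] with x hx
        rw [hx]
        exact enorm_sum_le _ _
    _ = ∫⁻ x, ∑ g ∈ F, ‖b g (g • x) (f x)‖ₑ ∂μ :=
        lintegral_sum_enorm_apply_wcompFun μ F hb hf
    _ ≤ _ := by
        refine lintegral_mono_ae ?_
        filter_upwards [ENNReal.ae_le_essSup fun x =>
          ⨆ u ∈ Metric.closedBall (0 : E) 1, ∑ g ∈ F, ‖b g (g • x) u‖ₑ] with x hx
        exact (sum_enorm_apply_le F (fun g => b g (g • x)) (f x)).trans (by gcongr)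

/-- The lower bound for the norm, tested on functions `1_Δ u` whose translates by `F` have essentially
disjoint supports. -/
theorem essSup_le_enorm_of_ae_eq_sum (hfree : MetricallyFree G μ)
    (hb : ∀ g, AEStronglyMeasurable (b g) μ)
    (hA : ∀ f, A f =ᵐ[μ] fun x => ∑ g ∈ F, b g x (wcompFun 𝕜 μ g f x)) :
    essSup (fun x => ⨆ u ∈ Metric.closedBall (0 : E) 1, ∑ g ∈ F, ‖b g (g • x) u‖ₑ) μ ≤ ‖A‖ₑ := by
  classical
  refine le_of_forall_lt fun c hc => ?_
  obtain ⟨c', hcc', hc'⟩ := exists_between hc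
  refine hcc'.trans_le ?_
  -- By the Lindelöf property a single vector `u` works for all `x` in a set of positive measure.
  obtain ⟨u, hu1, hu⟩ : ∃ u : E, ‖u‖ ≤ 1 ∧ ∃ᶠ x in ae μ, c' < ∑ g ∈ F, ‖b g (g • x) u‖ₑ := by
    have hB : AEStronglyMeasurable (fun x (g : F) => b g ((g : G) • x)) μ :=
      aestronglyMeasurable_pi fun g : F => (hb g).comp_quasiMeasurePreserving (quasi μ (g : G))
    obtain ⟨i, hi⟩ := exists_frequently_mem_of_frequently_mem_iUnion hB
      (U := fun u : Metric.closedBall (0 : E) 1 =>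
        {S : F → E →L[𝕜] E | c' < ∑ g : F, ‖S g (u : E)‖ₑ})
      (fun u => isOpen_lt continuous_const (by fun_prop)) <| by
        refine (Filter.frequently_lt_of_lt_limsup (by isBoundedDefault) hc').mono fun x hx => ?_
        obtain ⟨u, hu⟩ := lt_iSup_iff.1 hx
        obtain ⟨hu1, hu⟩ := lt_iSup_iff.1 hu
        rw [← Finset.sum_coe_sort] at hu
        exact Set.mem_iUnion.2 ⟨⟨u, hu1⟩, hu⟩
    refine ⟨i, mem_closedBall_zero_iff.1 i.2, hi.mono fun x hx => ?_⟩
    rw [← Finset.sum_coe_sort]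
    exact hx
  have hΦ : AEMeasurable (fun x => ∑ g ∈ F, ‖b g (g • x) u‖ₑ) μ :=
    Finset.aemeasurable_fun_sum _ fun g _ =>
      (aestronglyMeasurable_smul_apply μ g (hb g) aestronglyMeasurable_const).enorm
  obtain ⟨Δ₀, hΔ₀, hΔ₀m, hΔ₀e⟩ :=
    (nullMeasurableSet_lt aemeasurable_const hΦ :
      NullMeasurableSet {x | c' < ∑ g ∈ F, ‖b g (g • x) u‖ₑ} μ).exists_measurable_subset_ae_eq
  have hΔ₀pos : 0 < μ Δ₀ := by
    rw [measure_congr hΔ₀e, pos_iff_ne_zero]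
    exact frequently_ae_iff.1 hu
  obtain ⟨Δ₁, hΔ₁m, hΔ₁, hΔ₁pos, hΔ₁fin⟩ := Measure.exists_subset_measure_lt_top hΔ₀m hΔ₀pos
  obtain ⟨Δ, hΔm, hΔpos, hΔ, hdisj⟩ := hfree F Δ₁ hΔ₁m hΔ₁pos
  have hΔfin : μ Δ ≠ ∞ := ((measure_mono hΔ).trans_lt hΔ₁fin).ne
  have hf : AEStronglyMeasurable (Δ.indicator fun _ => u) μ :=
    aestronglyMeasurable_const.indicator hΔm
  set f : Lp E 1 μ := indicatorConstLp 1 hΔm hΔfin u with hfdef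
  have hfae : f =ᵐ[μ] Δ.indicator fun _ => u := indicatorConstLp_coeFn
  -- The supports `g • Δ`, `g ∈ F`, of the translates of `f` are disjoint up to a null set.
  have hdisj' : ∀ᵐ x ∂μ, ∀ g ∈ F, ∀ h ∈ F, g ≠ h → ¬ (g⁻¹ • x ∈ Δ ∧ h⁻¹ • x ∈ Δ) := by
    simp only [Finset.eventually_all, Filter.eventually_all]
    intro g hg h hh hgh
    refine measure_mono_null ?_ (hdisj g hg h hh hgh)
    intro x hx
    simp only [Set.mem_compl_iff, Set.mem_ofPred_eq, not_not] at hx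
    exact ⟨⟨_, hx.1, smul_inv_smul g x⟩, ⟨_, hx.2, smul_inv_smul h x⟩⟩
  have hAf : ‖A f‖ₑ = ∫⁻ x, ∑ g ∈ F, ‖b g (g • x) (Δ.indicator (fun _ => u) x)‖ₑ ∂μ := by
    rw [← lintegral_sum_enorm_apply_wcompFun μ F hb hf, Lp.enorm_def,
      eLpNorm_one_eq_lintegral_enorm]
    refine lintegral_congr_ae ?_
    have hw : ∀ᵐ x ∂μ, ∀ g ∈ F, wcompFun 𝕜 μ g f x = wcompFun 𝕜 μ g (Δ.indicator fun _ => u) x :=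
      (Finset.eventually_all F).2 fun g _ => wcompFun_congr 𝕜 μ g hfae
    filter_upwards [hA f, hw, hdisj'] with x hx hw hd
    have hzero : ∀ g : G, g⁻¹ • x ∉ Δ → wcompFun 𝕜 μ g (Δ.indicator fun _ => u) x = 0 := by
      intro g hg
      simp [wcompFun, hg]
    rw [hx, Finset.sum_congr rfl fun g hg => by rw [hw g hg]]
    -- At almost every `x` at most one summand is nonzero, so the norm is additive on the sum.
    by_cases hex : ∃ g ∈ F, g⁻¹ • x ∈ Δ
    · obtain ⟨g, hg, hgx⟩ := hex
      have hz : ∀ h ∈ F, h ≠ g → wcompFun 𝕜 μ h (Δ.indicator fun _ => u) x = 0 :=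
        fun h hh hhg => hzero h fun hhx => hd h hh g hg hhg ⟨hhx, hgx⟩
      rw [Finset.sum_eq_single_of_mem g hg fun h hh hhg => by simp [hz h hh hhg],
        Finset.sum_eq_single_of_mem g hg fun h hh hhg => by simp [hz h hh hhg]]
    · push Not at hex
      rw [Finset.sum_eq_zero fun g hg => by simp [hzero g (hex g hg)],
        Finset.sum_eq_zero fun g hg => by simp [hzero g (hex g hg)], enorm_zero]
  have hlow : c' * μ Δ ≤ ‖A f‖ₑ := by
    rw [hAf, ← lintegral_indicator_const hΔm]
    refine lintegral_mono fun x => ?_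
    by_cases hx : x ∈ Δ
    · simpa [hx] using (hΔ₀ (hΔ₁ (hΔ hx))).le
    · simp [hx]
  have hfle : ‖f‖ₑ ≤ μ Δ := by
    rw [Lp.enorm_def, eLpNorm_congr_ae hfae,
      eLpNorm_indicator_const hΔm one_ne_zero ENNReal.one_ne_top]
    have : ‖u‖ₑ ≤ 1 := enorm_le_one_iff.2 hu1
    simpa using mul_le_of_le_one_left' this
  exact (ENNReal.mul_le_mul_iff_left hΔpos.ne' hΔfin).1
    (hlow.trans (A.le_opENorm_of_le hfle))

end Sum

/-! ### Duality between vectors and families of functionals -/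

section Duality

variable {G 𝕜 E : Type*} [RCLike 𝕜] [NormedAddCommGroup E] [NormedSpace 𝕜 E] (F : Finset G)
  (S : F → E →L[𝕜] E)

theorem enorm_sum_dualOp_le {f : F → StrongDual 𝕜 E} (hf : f ∈ ballFamilies F (StrongDual 𝕜 E)) :
    ‖∑ g : F, dualOp (S g) (f g)‖ₑ ≤ ⨆ u ∈ Metric.closedBall (0 : E) 1, ∑ g : F, ‖S g u‖ₑ := by
  refine ContinuousLinearMap.opENorm_le_bound _ fun v => ?_
  refine le_trans ?_ (sum_enorm_apply_le Finset.univ S v)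
  rw [sum_apply]
  refine (enorm_sum_le _ _).trans (Finset.sum_le_sum fun g _ => ?_)
  have h1 : ‖f g‖ₑ ≤ 1 := enorm_le_one_iff.2 (hf g)
  rw [← one_mul ‖S g v‖ₑ]
  exact (f g).le_of_opENorm_le h1 (S g v)

/-- Hahn-Banach functionals norming the vectors `S_g u` turn the sum of norms into a single value of
`∑ S_g^* f_g`. Nontriviality of `E` guarantees functionals of norm exactly one even where
`S_g u = 0`. -/
theorem sum_enorm_le_iSup_sphereFamilies [Nontrivial E] {u : E} (hu : ‖u‖ ≤ 1) :
    ∑ g : F, ‖S g u‖ₑ ≤ ⨆ f ∈ sphereFamilies F (StrongDual 𝕜 E),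
      ‖∑ g : F, dualOp (S g) (f g)‖ₑ := by
  choose f hf1 hf using fun g : F => exists_dual_vector' 𝕜 (S g u)
  refine le_trans ?_ (le_iSup₂ (f := fun (f : F → StrongDual 𝕜 E) _ =>
    ‖∑ g : F, dualOp (S g) (f g)‖ₑ) f hf1)
  have hu' : ‖u‖ₑ ≤ 1 := enorm_le_one_iff.2 hu
  have h := (∑ g : F, dualOp (S g) (f g)).le_opENorm_of_le hu'
  rw [mul_one] at h
  refine le_trans (le_of_eq ?_) h
  have hval : (∑ g : F, dualOp (S g) (f g)) u = ((∑ g : F, ‖S g u‖ : ℝ) : 𝕜) := by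
    simp [dualOp, hf]
  have hnn : 0 ≤ ∑ g : F, ‖S g u‖ := Finset.sum_nonneg fun _ _ => norm_nonneg _
  rw [hval, ← ofReal_norm, RCLike.norm_ofReal, abs_of_nonneg hnn,
    ENNReal.ofReal_sum_of_nonneg fun _ _ => norm_nonneg _]
  simp [ofReal_norm]

theorem iSup_sphereFamilies_le_iSup_ballFamilies :
    ⨆ f ∈ sphereFamilies F (StrongDual 𝕜 E), ‖∑ g : F, dualOp (S g) (f g)‖ₑ ≤
      ⨆ f ∈ ballFamilies F (StrongDual 𝕜 E), ‖∑ g : F, dualOp (S g) (f g)‖ₑ :=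
  biSup_mono fun _ hf g => (hf g).le

theorem iSup_sphereFamilies_eq :
    ⨆ f ∈ sphereFamilies F (StrongDual 𝕜 E), ‖∑ g : F, dualOp (S g) (f g)‖ₑ =
      ⨆ u ∈ Metric.closedBall (0 : E) 1, ∑ g : F, ‖S g u‖ₑ := by
  refine le_antisymm ((iSup_sphereFamilies_le_iSup_ballFamilies F S).trans
    (iSup₂_le fun _ hf => enorm_sum_dualOp_le F S hf)) (iSup₂_le fun u hu => ?_)
  -- For `E = 0` the sphere is empty when `F` is nonempty, but then both sides are zero.
  cases subsingleton_or_nontrivial E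
  · simp [Subsingleton.elim (S _ u) 0]
  · exact sum_enorm_le_iSup_sphereFamilies F S (by simpa using hu)

theorem iSup_ballFamilies_eq :
    ⨆ f ∈ ballFamilies F (StrongDual 𝕜 E), ‖∑ g : F, dualOp (S g) (f g)‖ₑ =
      ⨆ u ∈ Metric.closedBall (0 : E) 1, ∑ g : F, ‖S g u‖ₑ :=
  le_antisymm (iSup₂_le fun _ hf => enorm_sum_dualOp_le F S hf)
    ((iSup_sphereFamilies_eq F S).symm.le.trans (iSup_sphereFamilies_le_iSup_ballFamilies F S))

theorem iSup_closedBall_sum_enorm_mul (s : Finset G) (c : G → 𝕜) :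
    ⨆ u ∈ Metric.closedBall (0 : 𝕜) 1, ∑ g ∈ s, ‖ContinuousLinearMap.mul 𝕜 𝕜 (c g) u‖ₑ =
      ∑ g ∈ s, ‖c g‖ₑ := by
  refine le_antisymm (iSup₂_le fun u hu => Finset.sum_le_sum fun g _ => ?_) ?_
  · have hu' : ‖u‖ₑ ≤ 1 := enorm_le_one_iff.2 (mem_closedBall_zero_iff.1 hu)
    simpa using mul_le_of_le_one_right' hu'
  · refine le_trans (le_of_eq ?_) (le_iSup₂ (f := fun (u : 𝕜) _ =>
      ∑ g ∈ s, ‖ContinuousLinearMap.mul 𝕜 𝕜 (c g) u‖ₑ) 1 (by simp))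
    simp

end Duality

/-! ### The norm formula -/

/-- The norm of `∑ g ∈ F, M_g T_g` in terms of vectors of `E`, where `M_g` is multiplication by a
strongly measurable operator-valued function `b g`. -/
theorem enorm_eq_essSup_of_ae_eq_sum {G Ω 𝕜 E : Type*} [Group G] [MulAction G Ω]
    [MeasurableSpace Ω] {μ : Measure Ω} [SigmaFinite μ] [PreservesMeasureClass G μ] [RCLike 𝕜]
    [NormedAddCommGroup E] [NormedSpace 𝕜 E] (hfree : MetricallyFree G μ) {F : Finset G}
    {b : G → Ω → E →L[𝕜] E} (hb : ∀ g, AEStronglyMeasurable (b g) μ)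
    {M : G → Lp E 1 μ →L[𝕜] Lp E 1 μ} (hM : ∀ g f, M g f =ᵐ[μ] fun x => b g x (f x)) :
    ‖∑ g ∈ F, M g ∘L (wcompIsometry 𝕜 E μ g).toContinuousLinearMap‖ₑ =
      essSup (fun x => ⨆ u ∈ Metric.closedBall (0 : E) 1, ∑ g ∈ F, ‖b g (g • x) u‖ₑ) μ := by
  have hA : ∀ f, (∑ g ∈ F, M g ∘L (wcompIsometry 𝕜 E μ g).toContinuousLinearMap) f =ᵐ[μ]
      fun x => ∑ g ∈ F, b g x (wcompFun 𝕜 μ g f x) := by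
    intro f
    rw [sum_apply]
    have h : ∀ᵐ x ∂μ, ∀ g ∈ F, (M g (wcompIsometry 𝕜 E μ g f)) x
        = b g x (wcompFun 𝕜 μ g f x) := by
      refine (Finset.eventually_all F).2 fun g _ => ?_
      filter_upwards [hM g (wcompIsometry 𝕜 E μ g f), wcompIsometry_ae 𝕜 μ g f] with x h1 h2
      rw [h1, h2]
      rfl
    filter_upwards [h, Lp.coeFn_finsetSum F
      fun g => M g (wcompIsometry 𝕜 E μ g f)] with x h1 h2
    rw [← Finset.sum_congr rfl h1]
    simpa using h2
  exact le_antisymm (enorm_le_essSup_of_ae_eq_sum hb hA)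
    (essSup_le_enorm_of_ae_eq_sum hfree hb hA)

end WeightedComposition

theorem mainTheorem4 {G Ω 𝕜 : Type*} [Group G] [MulAction G Ω] [MeasurableSpace Ω]
    (μ : Measure Ω) [SigmaFinite μ] [PreservesMeasureClass G μ] [RCLike 𝕜]
    (hfree : MetricallyFree G μ) (F : Finset G) :
    (∀ (E : Type*) [NormedAddCommGroup E] [NormedSpace 𝕜 E] [CompleteSpace E]
      (a : G → Lp (E →L[𝕜] E) ∞ μ),
      ‖∑ g ∈ F, multOp (a g) ∘L (wcompIsometry 𝕜 E μ g).toContinuousLinearMap‖ₑ =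
          essSup (fun x => ⨆ f ∈ ballFamilies F (StrongDual 𝕜 E),
            ‖∑ g : F, dualOp (a g ((g : G) • x)) (f g)‖ₑ) μ ∧
      ‖∑ g ∈ F, multOp (a g) ∘L (wcompIsometry 𝕜 E μ g).toContinuousLinearMap‖ₑ =
          essSup (fun x => ⨆ f ∈ sphereFamilies F (StrongDual 𝕜 E),
            ‖∑ g : F, dualOp (a g ((g : G) • x)) (f g)‖ₑ) μ) ∧
    (∀ a : G → Lp 𝕜 ∞ μ,
      ‖∑ g ∈ F, scalarMultOp (a g) ∘L (wcompIsometry 𝕜 𝕜 μ g).toContinuousLinearMap‖ₑ =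
        essSup (fun x => ∑ g ∈ F, ‖a g (g • x)‖ₑ) μ) := by
  refine ⟨fun E _ _ _ a => ?_, fun a => ?_⟩
  · have key := enorm_eq_essSup_of_ae_eq_sum hfree (F := F)
      (fun g => (Lp.memLp (a g)).1) (fun g f => multOp_ae (a g) f)
    simp only [iSup_ballFamilies_eq F fun g : F => a g ((g : G) • _),
      iSup_sphereFamilies_eq F fun g : F => a g ((g : G) • _), and_self]
    rw [key]
    congr! 5 with x u hu
    exact (Finset.sum_coe_sort F fun g => ‖a g (g • x) u‖ₑ).symm
  · rw [enorm_eq_essSup_of_ae_eq_sum hfree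
      (b := fun g x => ContinuousLinearMap.mul 𝕜 𝕜 (a g x))
      (fun g => (ContinuousLinearMap.mul 𝕜 𝕜).continuous.comp_aestronglyMeasurable
        (Lp.memLp (a g)).1) (fun g f => scalarMultOp_ae (a g) f)]
    simp only [iSup_closedBall_sum_enorm_mul F fun g => a g (g • _)]
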